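/- Let $n\ge 2$ and let $X$ be a set. An *idempotent $n$-semigroup* is a set $A$ with an $n$-ary operation $f$ such that $f(a,\dots,a)=a$ and, for all $a_1,\dots,a_{2n-1}\in A$, the elements $f(a_1,\dots,a_i,f(a_{i+1},\dots,a_{i+n}),a_{i+n+1},\dots,a_{2n-1})$, $0\le i\le n-1$, all coincide. A *semilattice ordered idempotent $n$-semigroup* is an algebra $(A,f,+)$ in which $(A,f)$ is an idempotent $n$-semigroup, $+$ is associative, commutative and idempotent, and $f(x_1,\dots,x_i+y_i,\dots,x_n)=f(x_1,\dots,x_i,\dots,x_n)+f(x_1,\dots,y_i,\dots,x_n)$ for each $1\le i\le n$; these algebras form the variety $\mathcal S_{\mathcal A_{I_n}}$. A *translation* of $(A,f)$ is a composition of finitely many (possibly zero) maps $x\mapsto f(b_1,\dots,b_{i-1},x,b_{i+1},\dots,b_n)$ with $b_j\in A$; equivalently, a map $x\mapsto p\,x\,q$ where $p,q$ are possibly empty words over $A$ whose total length is divisible by $n-1$. A subset $B\subseteq A$ is a *closed $n$-semigroup* if for every translation $T$ and all $u_1,\dots,u_n\in A$, $$T(u_1),\dots,T(u_n)\in B\ \Longrightarrow\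 T(f(u_1,\dots,u_n))\in B$$ (with $T$ the identity: $B$ is closed under $f$). For $Y\subseteq A$ let $[Y]$ be the least closed $n$-semigroup containing $Y$, and let $\mathcal P_{fin\,C}A=\{[Y]\mid \emptyset\ne Y\subseteq A,\ Y\text{ finite}\}$, with the operations $$f_C(B_1,\dots,B_n)=[\{f(b_1,\dots,b_n)\mid b_i\in B_i\}],\qquad B+C=[B\cup C].$$ **Theorem 6.2.** Let $F$ be the free idempotent $n$-semigroup over $X$. Then $(\mathcal P_{fin\,C}F,f_C,+)$ is a semilattice ordered idempotent $n$-semigroup, and it is isomorphic to the free algebra over $X$ in $\mathcal S_{\mathcal A_{I_n}}$, by an isomorphism which sends each free generator $x\in X$ to $[\{x\}]$. That is, for every $(A,f,+)\in\mathcal S_{\mathcal A_{I_n}}$ and every map $h:X\to A$ there is exactly one homomorphism $g:(\mathcal P_{fin\,C}F,f_C,+)\to(A,f,+)$ with $g([\{x\}])=h(x)$ for all $x\in X$. (For $n=2$, where a closed $2$-semigroup is a subsemigroup $B$ such that $puq,pvq\in B$ implies $puvq\in B$ for all $p,q\in A^1$, $u,v\in A$, this is Zhao's theorem.) -/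

import Mathlib

universe u v

noncomputable section

/-- A set with one `n`-ary operation. -/
class NaryOp (n : ℕ) (A : Type*) where
  op : (Fin n → A) → A

namespace NSgp

open Function

/-- The product of `a 0, …, a (2 n - 2)` bracketed so that the inner operation is applied to
`a i, …, a (i + n - 1)`, i.e.
`f (a 0, …, a (i - 1), f (a i, …, a (i + n - 1)), a (i + n), …, a (2 n - 2))` (for `i < n`). -/
def nested (n : ℕ) {A : Type*} [NaryOp n A] (i : ℕ) (a : ℕ → A) : A :=
  NaryOp.op fun k : Fin n =>
    if (k : ℕ) < i then a k
    else if (k : ℕ) = i then NaryOp.op fun l : Fin n => a (i + l)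
    else a (k + (n - 1))

/-- `(A, f)` is an idempotent `n`-semigroup. -/
structure IsIdempotentNSemigroup (n : ℕ) (A : Type*) [NaryOp n A] : Prop where
  assoc : ∀ (a : ℕ → A) (i j : ℕ), i < n → j < n → nested n i a = nested n j a
  idem : ∀ a : A, NaryOp.op (fun _ : Fin n => a) = a

/-- `(A, f, +)` is a semilattice ordered idempotent `n`-semigroup. -/
structure IsSemilatticeOrdered (n : ℕ) (A : Type*) [NaryOp n A] [Add A] : Prop extends
    IsIdempotentNSemigroup n A where
  add_assoc : ∀ x y z : A, x + y + z = x + (y + z)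
  add_comm : ∀ x y : A, x + y = y + x
  add_idem : ∀ x : A, x + x = x
  op_add : ∀ (a : Fin n → A) (i : Fin n) (x y : A),
    NaryOp.op (update a i (x + y)) = NaryOp.op (update a i x) + NaryOp.op (update a i y)

/-- Homomorphisms of algebras `(A, f, +)`. -/
structure IsHom (n : ℕ) {A B : Type*} [NaryOp n A] [Add A] [NaryOp n B] [Add B]
    (g : A → B) : Prop where
  map_op : ∀ a : Fin n → A, g (NaryOp.op a) = NaryOp.op fun i => g (a i)
  map_add : ∀ x y : A, g (x + y) = g x + g y

/-! ### Closed `n`-semigroups -/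

section Closed

variable (n : ℕ) {A : Type*} [NaryOp n A]

/-- Translations of `(A, f)`: the finite (possibly empty) compositions of maps
`x ↦ f (b 0, …, b (i - 1), x, b (i + 1), …, b (n - 1))`.  In an `n`-semigroup they are the maps
`x ↦ p x q` for words `p`, `q` (each possibly empty) over `A` whose total length is a
multiple of `n - 1`. -/
inductive IsTranslation : (A → A) → Prop
  | id : IsTranslation fun x => x
  | comp {T : A → A} (b : Fin n → A) (i : Fin n) (hT : IsTranslation T) :
      IsTranslation fun x => NaryOp.op (update b i (T x))

/-- `B` is a closed `n`-semigroup: for every translation `T`, if `T (u k) ∈ B` for all `k`, then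
`T (f u) ∈ B`.  With `T` the identity, this says that `B` is closed under `f`. -/
def IsClosedSub (B : Set A) : Prop :=
  ∀ T : A → A, IsTranslation n T → ∀ u : Fin n → A,
    (∀ k, T (u k) ∈ B) → T (NaryOp.op u) ∈ B

/-- `[X]`: the closed `n`-semigroup generated by `X`. -/
def closedHull (X : Set A) : Set A :=
  ⋂₀ {B | IsClosedSub n B ∧ X ⊆ B}

/-- The complex operation `f (B 0, …, B (n - 1)) = {f (b 0, …, b (n - 1)) | b i ∈ B i}`. -/
def complexOp (B : Fin n → Set A) : Set A :=
  NaryOp.op '' Set.univ.pi B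

variable {n}

theorem subset_closedHull (X : Set A) : X ⊆ closedHull n X :=
  fun _ hx _ hB => hB.2 hx

theorem closedHull_subset {X B : Set A} (hB : IsClosedSub n B) (h : X ⊆ B) :
    closedHull n X ⊆ B :=
  fun _ hx => hx B ⟨hB, h⟩

theorem isClosedSub_closedHull (X : Set A) : IsClosedSub n (closedHull n X) :=
  fun T hT u hu B hB => hB.1 T hT u fun k => hu k B hB

theorem closedHull_mono {X Y : Set A} (h : X ⊆ Y) : closedHull n X ⊆ closedHull n Y :=
  closedHull_subset (isClosedSub_closedHull Y) (h.trans (subset_closedHull Y))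

theorem isClosedSub_preimage {C : Set A} (hC : IsClosedSub n C) (b : Fin n → A) (i : Fin n) :
    IsClosedSub n {x | NaryOp.op (update b i x) ∈ C} :=
  fun _ hT u hu => hC _ (hT.comp b i) u hu

theorem complexOp_closedHull_subset (X : Fin n → Set A) :
    complexOp n (fun i => closedHull n (X i)) ⊆ closedHull n (complexOp n X) := by
  have key : ∀ (s : Finset (Fin n)) (a : Fin n → A), (∀ i ∈ s, a i ∈ closedHull n (X i)) →
      (∀ i ∉ s, a i ∈ X i) → NaryOp.op a ∈ closedHull n (complexOp n X) := by
    intro s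
    induction s using Finset.induction_on with
    | empty =>
      intro a _ h
      exact subset_closedHull _ ⟨a, fun i _ => h i (Finset.notMem_empty i), rfl⟩
    | insert j s hj ih =>
      intro a h1 h2
      have hsub : closedHull n (X j) ⊆
          {x | NaryOp.op (update a j x) ∈ closedHull n (complexOp n X)} := by
        refine closedHull_subset (isClosedSub_preimage (isClosedSub_closedHull _) a j) ?_
        intro x hx
        refine ih _ (fun i hi => ?_) (fun i hi => ?_)
        · have hij : i ≠ j := fun e => hj (e ▸ hi)
          rw [update_of_ne hij]
          exact h1 i (Finset.mem_insert_of_mem hi)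
        · by_cases hij : i = j
          · subst hij
            simpa using hx
          · rw [update_of_ne hij]
            exact h2 i (by simp [hij, hi])
      have := hsub (h1 j (Finset.mem_insert_self j s))
      simpa using this
  rintro _ ⟨a, ha, rfl⟩
  exact key Finset.univ a (fun i _ => ha i trivial) (fun i hi => absurd (Finset.mem_univ i) hi)

theorem closedHull_complexOp (X : Fin n → Set A) :
    closedHull n (complexOp n fun i => closedHull n (X i)) = closedHull n (complexOp n X) :=
  (closedHull_subset (isClosedSub_closedHull _) (complexOp_closedHull_subset X)).antisymm
    (closedHull_mono (Set.image_mono (Set.pi_mono fun i _ => subset_closedHull (X i))))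

theorem closedHull_union (X Y : Set A) :
    closedHull n (closedHull n X ∪ closedHull n Y) = closedHull n (X ∪ Y) :=
  (closedHull_subset (isClosedSub_closedHull _) (Set.union_subset
      (closedHull_mono Set.subset_union_left) (closedHull_mono Set.subset_union_right))).antisymm
    (closedHull_mono (Set.union_subset_union (subset_closedHull X) (subset_closedHull Y)))

end Closed

/-- The set of non-empty, finitely generated closed `n`-semigroups of `(A, f)`. -/
def FinClosed (n : ℕ) (A : Type*) [NaryOp n A] : Type _ :=
  {B : Set A // ∃ G : Set A, G.Finite ∧ G.Nonempty ∧ B = closedHull n G}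

namespace FinClosed

variable {n : ℕ} {A : Type*} [NaryOp n A]

/-- `[{a}]`. -/
def single (a : A) : FinClosed n A :=
  ⟨closedHull n {a}, {a}, Set.finite_singleton a, Set.singleton_nonempty a, rfl⟩

/-- `f_C (B 0, …, B (n - 1)) = [f (B 0, …, B (n - 1))]`. -/
instance : NaryOp n (FinClosed n A) where
  op B := ⟨closedHull n (complexOp n fun i => (B i).1), by
    choose G hfin hne hG using fun i => (B i).2
    refine ⟨complexOp n G, (Set.Finite.pi hfin).image _, ?_, ?_⟩
    · exact (Set.univ_pi_nonempty_iff.2 hne).image _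
    · simp only [hG]
      exact closedHull_complexOp G⟩

/-- `B + C = [B ∪ C]`. -/
instance : Add (FinClosed n A) where
  add B C := ⟨closedHull n (B.1 ∪ C.1), by
    obtain ⟨G, hGf, hGn, hG⟩ := B.2
    obtain ⟨H, hHf, -, hH⟩ := C.2
    refine ⟨G ∪ H, hGf.union hHf, hGn.inl, ?_⟩
    rw [hG, hH]
    exact closedHull_union G H⟩

end FinClosed

/-! ### Free algebras: terms modulo the congruence generated by the defining identities -/

/-- Terms over `X` in one `n`-ary operation symbol. -/
inductive Term (n : ℕ) (X : Type u) : Type u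
  | var : X → Term n X
  | op : (Fin n → Term n X) → Term n X

instance (n : ℕ) (X : Type u) : NaryOp n (Term n X) := ⟨Term.op⟩

/-- The least congruence on terms containing all instances of the identities of idempotent
`n`-semigroups. -/
inductive TermRel (n : ℕ) (X : Type u) : Term n X → Term n X → Prop
  | refl (s) : TermRel n X s s
  | symm {s t} : TermRel n X s t → TermRel n X t s
  | trans {s t r} : TermRel n X s t → TermRel n X t r → TermRel n X s r
  | congr {a b : Fin n → Term n X} :
      (∀ i, TermRel n X (a i) (b i)) → TermRel n X (NaryOp.op a) (NaryOp.op b)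
  | assoc (a : ℕ → Term n X) (i j : ℕ) :
      i < n → j < n → TermRel n X (nested n i a) (nested n j a)
  | idem (s : Term n X) : TermRel n X (NaryOp.op fun _ : Fin n => s) s

instance termSetoid (n : ℕ) (X : Type u) : Setoid (Term n X) :=
  ⟨TermRel n X, .refl, .symm, .trans⟩

/-- The free idempotent `n`-semigroup over `X`. -/
def FreeINS (n : ℕ) (X : Type u) : Type u := Quotient (termSetoid n X)

namespace FreeINS

variable {n : ℕ} {X : Type u}

instance : NaryOp n (FreeINS n X) where
  op a := Quotient.mk _ (NaryOp.op fun i => Quotient.out (a i))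

/-- The free generators. -/
def of (x : X) : FreeINS n X := Quotient.mk _ (Term.var x)

end FreeINS

/-- Terms over `X` in one `n`-ary operation symbol and a binary symbol `+`. -/
inductive SLTerm (n : ℕ) (X : Type u) : Type u
  | var : X → SLTerm n X
  | op : (Fin n → SLTerm n X) → SLTerm n X
  | add : SLTerm n X → SLTerm n X → SLTerm n X

instance (n : ℕ) (X : Type u) : NaryOp n (SLTerm n X) := ⟨SLTerm.op⟩

instance (n : ℕ) (X : Type u) : Add (SLTerm n X) := ⟨SLTerm.add⟩

/-- The least congruence on terms containing all instances of the identities of semilattice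
ordered idempotent `n`-semigroups. -/
inductive SLTermRel (n : ℕ) (X : Type u) : SLTerm n X → SLTerm n X → Prop
  | refl (s) : SLTermRel n X s s
  | symm {s t} : SLTermRel n X s t → SLTermRel n X t s
  | trans {s t r} : SLTermRel n X s t → SLTermRel n X t r → SLTermRel n X s r
  | op_congr {a b : Fin n → SLTerm n X} :
      (∀ i, SLTermRel n X (a i) (b i)) → SLTermRel n X (NaryOp.op a) (NaryOp.op b)
  | add_congr {s s' t t'} :
      SLTermRel n X s s' → SLTermRel n X t t' → SLTermRel n X (s + t) (s' + t')
  | assoc (a : ℕ → SLTerm n X) (i j : ℕ) :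
      i < n → j < n → SLTermRel n X (nested n i a) (nested n j a)
  | idem (s : SLTerm n X) : SLTermRel n X (NaryOp.op fun _ : Fin n => s) s
  | add_assoc (s t r) : SLTermRel n X (s + t + r) (s + (t + r))
  | add_comm (s t) : SLTermRel n X (s + t) (t + s)
  | add_idem (s) : SLTermRel n X (s + s) s
  | op_add (a : Fin n → SLTerm n X) (i : Fin n) (s t : SLTerm n X) :
      SLTermRel n X (NaryOp.op (update a i (s + t)))
        (NaryOp.op (update a i s) + NaryOp.op (update a i t))

instance slTermSetoid (n : ℕ) (X : Type u) : Setoid (SLTerm n X) :=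
  ⟨SLTermRel n X, .refl, .symm, .trans⟩

/-- The free semilattice ordered idempotent `n`-semigroup over `X`. -/
def FreeSL (n : ℕ) (X : Type u) : Type u := Quotient (slTermSetoid n X)

namespace FreeSL

variable {n : ℕ} {X : Type u}

instance : NaryOp n (FreeSL n X) where
  op a := Quotient.mk _ (NaryOp.op fun i => Quotient.out (a i))

instance : Add (FreeSL n X) where
  add := Quotient.map₂ (· + ·) fun _ _ h _ _ h' => SLTermRel.add_congr h h'

/-- The free generators. -/
def of (x : X) : FreeSL n X := Quotient.mk _ (SLTerm.var x)

end FreeSL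

end NSgp

end

namespace NSgp

open Function

/-! Extend `h` to a homomorphism `φ` from the free idempotent `n`-semigroup to `(A, f)`, and send
`[G]` to the join of `φ '' G` for the order given by `+`. This depends only on `[G]` because each
set `{x | φ x ≤ s}` is closed (`isClosedSub_setOf_map_le`): `f` is monotone and idempotent in `A`,
and translations preserve joins. Hence `φ '' G` and `φ '' [G]` have the same upper bounds.
Distributivity makes the join compatible with `f_C` and `+`.

The map is unique because every `[G]` is a finite sum of sets `[{a}]` and `a ↦ [{a}]` respects `f`.
The identities hold for closed sets since associativity is linear in its variables, so passes to
complex products (`nested_val`), while idempotence comes from closure under `f`. The isomorphism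
follows by comparing the two universal properties. -/

/-- Coordinates pass from `S` to `S'` one at a time. This turns one-variable facts about `f` into
facts about all its arguments. -/
theorem forall_pi_of_forall_update {n : ℕ} {A : Type*} {S S' : Fin n → Set A}
    {P : (Fin n → A) → Prop}
    (step : ∀ a j, (∀ x ∈ S j, P (update a j x)) → ∀ x ∈ S' j, P (update a j x))
    (h : ∀ a, (∀ i, a i ∈ S i) → P a) (a : Fin n → A) (ha : ∀ i, a i ∈ S' i) : P a := by
  have key : ∀ (s : Finset (Fin n)) (a : Fin n → A), (∀ i ∈ s, a i ∈ S' i) →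
      (∀ i ∉ s, a i ∈ S i) → P a := by
    intro s
    induction s using Finset.induction_on with
    | empty => exact fun a _ h' => h a fun i => h' i (Finset.notMem_empty i)
    | insert j s hj ih =>
      intro a h1 h2
      rw [← update_eq_self j a]
      refine step a j (fun x hx => ih _ (fun i hi => ?_) fun i hi => ?_) _
        (h1 j (Finset.mem_insert_self j s))
      · have hij : i ≠ j := fun e => hj (e ▸ hi)
        rw [update_of_ne hij]
        exact h1 i (Finset.mem_insert_of_mem hi)
      · by_cases hij : i = j
        · subst hij
          simpa using hx
        · rw [update_of_ne hij]
          exact h2 i (by simp [hij, hi])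
  exact key Finset.univ a (fun i _ => ha i) fun i hi => absurd (Finset.mem_univ i) hi

theorem map_nested {n : ℕ} {A B : Type*} [NaryOp n A] [NaryOp n B] {φ : A → B}
    (hφ : ∀ a : Fin n → A, φ (NaryOp.op a) = NaryOp.op fun i => φ (a i)) (i : ℕ) (a : ℕ → A) :
    φ (nested n i a) = nested n i fun k => φ (a k) := by
  unfold nested
  rw [hφ]
  congr 1
  funext k
  split_ifs
  · rfl
  · exact hφ _
  · rfl

/-! ### Suprema of images of finitely generated closed `n`-semigroups -/

section Sup

variable {n : ℕ} {A F : Type*} [NaryOp n A] [SemilatticeSup A] [NaryOp n F]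

theorem op_update_mono
    (hsup : ∀ (a : Fin n → A) (i : Fin n) (x y : A), NaryOp.op (update a i (x ⊔ y)) =
      NaryOp.op (update a i x) ⊔ NaryOp.op (update a i y)) (a : Fin n → A) (i : Fin n) :
    Monotone fun x => NaryOp.op (update a i x) := by
  intro x y h
  have := hsup a i x y
  rw [sup_eq_right.2 h] at this
  exact le_of_le_of_eq le_sup_left this.symm

theorem op_mono
    (hsup : ∀ (a : Fin n → A) (i : Fin n) (x y : A), NaryOp.op (update a i (x ⊔ y)) =
      NaryOp.op (update a i x) ⊔ NaryOp.op (update a i y)) :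
    Monotone (NaryOp.op : (Fin n → A) → A) := by
  intro a b hab
  refine forall_pi_of_forall_update (S := fun i => {a i}) (S' := fun i => {b i})
    (P := fun c => NaryOp.op a ≤ NaryOp.op c) ?_ ?_ b fun i => rfl
  · rintro c j h _ rfl
    exact (h (a j) rfl).trans (op_update_mono hsup c j (hab j))
  · intro c hc
    rw [show c = a from funext hc]

theorem isClosedSub_setOf_map_le (hn : 0 < n)
    (hsup : ∀ (a : Fin n → A) (i : Fin n) (x y : A), NaryOp.op (update a i (x ⊔ y)) =
      NaryOp.op (update a i x) ⊔ NaryOp.op (update a i y))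
    (hidem : ∀ a : A, NaryOp.op (fun _ : Fin n => a) = a) {φ : F → A}
    (hφ : ∀ a : Fin n → F, φ (NaryOp.op a) = NaryOp.op fun i => φ (a i)) (s : A) :
    IsClosedSub n {x | φ x ≤ s} := by
  intro T hT u hu
  -- Through `φ`, the translation `T` becomes a translation `T'` of `A`, which preserves binary
  -- joins by distributivity.
  obtain ⟨T', hT', hTT⟩ : ∃ T' : A → A, (∀ x y, T' (x ⊔ y) = T' x ⊔ T' y) ∧
      ∀ x, φ (T x) = T' (φ x) := by
    clear hu
    induction hT with
    | id => exact ⟨fun x => x, fun _ _ => rfl, fun _ => rfl⟩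
    | comp b i _ ih =>
      obtain ⟨T', h1, h2⟩ := ih
      refine ⟨fun x => NaryOp.op (update (fun k => φ (b k)) i (T' x)), fun x y => ?_, fun x => ?_⟩
      · simp only [h1, hsup]
      · rw [hφ]
        refine (congrArg NaryOp.op (comp_update φ b i _)).trans ?_
        rw [h2]
        rfl
  have hmono : Monotone T' := fun x y h =>
    le_of_le_of_eq le_sup_left ((hT' x y).symm.trans (by rw [sup_eq_right.2 h]))
  have hne : (Finset.univ : Finset (Fin n)).Nonempty := ⟨⟨0, hn⟩, Finset.mem_univ _⟩
  simp only [Set.mem_ofPred_eq, hTT, hφ] at hu ⊢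
  -- Raise every argument of `f` to the common join, collapse by idempotence, then distribute `T'`
  -- over that join.
  calc T' (NaryOp.op fun i => φ (u i))
      ≤ T' (NaryOp.op fun _ : Fin n => Finset.univ.sup' hne fun i => φ (u i)) :=
        hmono (op_mono hsup fun i => Finset.le_sup' (fun i => φ (u i)) (Finset.mem_univ i))
    _ = T' (Finset.univ.sup' hne fun i => φ (u i)) := by rw [hidem]
    _ ≤ s := Finset.sup'_induction (p := fun x => T' x ≤ s) hne _
        (fun x hx y hy => (hT' x y).trans_le (sup_le hx hy)) fun i _ => hu i

variable (hn : 0 < n)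
    (hsup : ∀ (a : Fin n → A) (i : Fin n) (x y : A), NaryOp.op (update a i (x ⊔ y)) =
      NaryOp.op (update a i x) ⊔ NaryOp.op (update a i y))
    (hidem : ∀ a : A, NaryOp.op (fun _ : Fin n => a) = a) {φ : F → A}
    (hφ : ∀ a : Fin n → F, φ (NaryOp.op a) = NaryOp.op fun i => φ (a i))

include hn hsup hidem hφ

theorem isLUB_image_closedHull {G : Set F} {s : A} :
    IsLUB (φ '' closedHull n G) s ↔ IsLUB (φ '' G) s := by
  refine isLUB_congr (Set.Subset.antisymm (upperBounds_mono_set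
    (Set.image_mono (subset_closedHull G))) fun t ht => ?_)
  rintro _ ⟨x, hx, rfl⟩
  exact closedHull_subset (isClosedSub_setOf_map_le hn hsup hidem hφ t)
    (fun y hy => ht ⟨y, hy, rfl⟩) hx

theorem FinClosed.exists_isLUB (B : FinClosed n F) : ∃ s, IsLUB (φ '' B.1) s := by
  obtain ⟨_, G, hfin, hne, rfl⟩ := B
  simp only [isLUB_image_closedHull hn hsup hidem hφ]
  have hfin' := hfin.image φ
  refine ⟨hfin'.toFinset.sup' ((hfin'.toFinset_nonempty).2 (hne.image φ)) id, ?_⟩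
  simpa using Finset.isLUB_sup' ((hfin'.toFinset_nonempty).2 (hne.image φ))

theorem FinClosed.isLUB_add {B C : FinClosed n F} {s t : A} (hs : IsLUB (φ '' B.1) s)
    (ht : IsLUB (φ '' C.1) t) : IsLUB (φ '' (B + C).1) (s ⊔ t) := by
  refine (isLUB_image_closedHull hn hsup hidem hφ).2 ?_
  rw [Set.image_union]
  exact hs.union ht

/-- Monotonicity gives the upper bound. For leastness, each `s i` is a finite join over generators,
and `f` distributes over it in one coordinate at a time. -/
theorem FinClosed.isLUB_op {B : Fin n → FinClosed n F} {s : Fin n → A}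
    (hs : ∀ i, IsLUB (φ '' (B i).1) (s i)) :
    IsLUB (φ '' (NaryOp.op B : FinClosed n F).1) (NaryOp.op s) := by
  refine (isLUB_image_closedHull hn hsup hidem hφ).2 ⟨?_, fun t ht => ?_⟩
  · rintro _ ⟨_, ⟨b, hb, rfl⟩, rfl⟩
    rw [hφ]
    exact op_mono hsup fun i => (hs i).1 ⟨b i, hb i trivial, rfl⟩
  · choose G hfin hne hG using fun i => (B i).2
    refine forall_pi_of_forall_update (S := fun i => φ '' G i) (S' := fun i => {s i})
      (P := fun c => NaryOp.op c ≤ t) ?_ ?_ s fun i => rfl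
    · rintro c j h _ rfl
      have hfin' := (hfin j).image φ
      have hne' := (hfin'.toFinset_nonempty).2 ((hne j).image φ)
      have hs' : s j = hfin'.toFinset.sup' hne' id := by
        have := hs j
        rw [hG j, isLUB_image_closedHull hn hsup hidem hφ] at this
        refine this.unique ?_
        simpa using Finset.isLUB_sup' hne'
      rw [hs']
      exact Finset.sup'_induction (p := fun x => NaryOp.op (update c j x) ≤ t) hne' _
        (fun x hx y hy => (hsup c j x y).trans_le (sup_le hx hy))
        fun x hx => h x (hfin'.mem_toFinset.1 hx)
    · intro c hc
      choose b hb hbc using hc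
      refine ht ⟨NaryOp.op b, ⟨b, fun i _ => ?_, rfl⟩, ?_⟩
      · exact (hG i).symm.subset (subset_closedHull _ (hb i))
      · rw [hφ]
        exact congrArg _ (funext hbc)

end Sup

/-- The semilattice order of an algebra `(A, f, +)`. -/
abbrev IsSemilatticeOrdered.semilatticeSup {n : ℕ} {A : Type*} [NaryOp n A] [Add A]
    (hA : IsSemilatticeOrdered n A) : SemilatticeSup A :=
  letI : Max A := ⟨(· + ·)⟩
  SemilatticeSup.mk' hA.add_comm hA.add_assoc hA.add_idem

/-! ### The algebra of finitely generated closed `n`-semigroups -/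

namespace FinClosed

variable {n : ℕ} {A : Type*} [NaryOp n A]

theorem closedHull_val (B : FinClosed n A) : closedHull n B.1 = B.1 := by
  obtain ⟨_, G, -, -, rfl⟩ := B
  exact (closedHull_subset (isClosedSub_closedHull G) subset_rfl).antisymm (subset_closedHull _)

theorem nonempty (B : FinClosed n A) : B.1.Nonempty := by
  obtain ⟨_, G, -, hG, rfl⟩ := B
  exact hG.mono (subset_closedHull G)

theorem op_val_of_closedHull_eq {B : Fin n → FinClosed n A} {Y : Fin n → Set A}
    (h : ∀ i, (B i).1 = closedHull n (Y i)) :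
    (NaryOp.op B : FinClosed n A).1 = closedHull n (complexOp n Y) := by
  refine Eq.trans ?_ (closedHull_complexOp Y)
  exact congrArg (fun Z => closedHull n (complexOp n Z)) (funext h)

/-- Each variable occurs once in the nested product, so independent choices of elements in the inner
and outer products assemble into one sequence. When `A` is associative, the generating set on the
right does not depend on `i`. -/
theorem nested_val (i : ℕ) (hi : i < n) (B : ℕ → FinClosed n A) :
    (nested n i B).1 =
      closedHull n {x | ∃ a : ℕ → A, (∀ k, a k ∈ (B k).1) ∧ nested n i a = x} := by
  unfold nested
  rw [op_val_of_closedHull_eq (Y := fun k : Fin n => if (k : ℕ) < i then (B k).1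
    else if (k : ℕ) = i then complexOp n (fun l : Fin n => (B (i + l)).1)
    else (B (k + (n - 1))).1)]
  · congr 1
    ext x
    constructor
    · rintro ⟨c, hc, rfl⟩
      have hc' : ∀ k : Fin n, c k ∈ if (k : ℕ) < i then (B k).1
        else if (k : ℕ) = i then complexOp n (fun l : Fin n => (B (i + l)).1)
        else (B (k + (n - 1))).1 := fun k => hc k trivial
      have hci := hc' ⟨i, hi⟩
      simp only [lt_irrefl, if_false, if_true] at hci
      obtain ⟨d, hd, hdc⟩ := hci
      choose e he using fun k => (B k).nonempty
      -- The inner factors `d` occupy positions `i, …, i + n - 1`, and later outer factors are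
      -- shifted by `n - 1`. From `2 n - 1` on, `e` is mere padding.
      refine ⟨fun m => if h : m < i then c ⟨m, h.trans hi⟩
        else if h' : m - i < n then d ⟨m - i, h'⟩
        else if h'' : m - (n - 1) < n then c ⟨m - (n - 1), h''⟩ else e m, fun m => ?_, ?_⟩
      · dsimp only
        split_ifs with h h' h''
        · simpa [h] using hc' ⟨m, h.trans hi⟩
        · have := hd ⟨m - i, h'⟩ trivial
          simpa [Nat.add_sub_cancel' (not_lt.1 h)] using this
        · have := hc' ⟨m - (n - 1), h''⟩
          rw [if_neg (by simp only; omega), if_neg (by simp only; omega)] at this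
          rwa [show m - (n - 1) + (n - 1) = m by omega] at this
        · exact he m
      · congr 1
        funext k
        dsimp only
        split_ifs with h1 h2 h3 h4 h5
        · rfl
        · rw [show k = ⟨i, hi⟩ from Fin.ext h2, ← hdc]
          congr 1
          funext l
          simp
        · omega
        · omega
        · congr 1
          exact Fin.ext (by simp)
        · omega
    · rintro ⟨a, ha, rfl⟩
      refine ⟨_, fun k _ => ?_, rfl⟩
      dsimp only
      split_ifs
      · exact ha _
      · exact ⟨_, fun l _ => ha _, rfl⟩
      · exact ha _
  · intro k
    split_ifs
    · exact (closedHull_val _).symm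
    · rfl
    · exact (closedHull_val _).symm

theorem add_val_of_closedHull_eq {B C : FinClosed n A} {Y Z : Set A}
    (hB : B.1 = closedHull n Y) (hC : C.1 = closedHull n Z) :
    (B + C).1 = closedHull n (Y ∪ Z) := by
  refine Eq.trans ?_ (closedHull_union Y Z)
  rw [← hB, ← hC]
  rfl

theorem complexOp_update_union (Y : Fin n → Set A) (i : Fin n) (C D : Set A) :
    complexOp n (update Y i (C ∪ D)) =
      complexOp n (update Y i C) ∪ complexOp n (update Y i D) := by
  unfold complexOp
  rw [← Set.image_union]
  congr 1
  ext b
  simp only [Set.mem_pi, Set.mem_univ, true_implies, Set.mem_union]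
  have key : ∀ E : Set A, (∀ k, b k ∈ update Y i E k) ↔ b i ∈ E ∧ ∀ k, k ≠ i → b k ∈ Y k :=
    fun E => forall_update_iff Y fun k s => b k ∈ s
  rw [key, key, key, Set.mem_union, or_and_right]

theorem isSemilatticeOrdered (hA : IsIdempotentNSemigroup n A) :
    IsSemilatticeOrdered n (FinClosed n A) where
  assoc B i j hi hj := by
    refine Subtype.ext ?_
    simp only [nested_val _ hi, nested_val _ hj, hA.assoc _ i j hi hj]
  idem B := by
    refine Subtype.ext (Set.Subset.antisymm ?_ fun b hb => ?_)
    · rw [← closedHull_val B]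
      refine closedHull_subset (isClosedSub_closedHull _) ?_
      rintro _ ⟨b, hb, rfl⟩
      exact isClosedSub_closedHull B.1 _ .id b fun k => by
        rw [closedHull_val]; exact hb k trivial
    · exact subset_closedHull _ ⟨fun _ => b, fun _ _ => hb, hA.idem b⟩
  add_assoc B C D := Subtype.ext (by
    rw [add_val_of_closedHull_eq (B := B + C) rfl (closedHull_val D).symm,
      add_val_of_closedHull_eq (C := C + D) (closedHull_val B).symm rfl, Set.union_assoc])
  add_comm B C := Subtype.ext (congrArg (closedHull n) (Set.union_comm B.1 C.1))
  add_idem B := Subtype.ext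
    ((congrArg (closedHull n) (Set.union_self B.1)).trans (closedHull_val B))
  op_add B i C D := by
    have key : ∀ E : FinClosed n A, ∀ Y, E.1 = closedHull n Y →
        (NaryOp.op (update B i E) : FinClosed n A).1 =
          closedHull n (complexOp n (update (fun k => (B k).1) i Y)) := by
      intro E Y hE
      refine op_val_of_closedHull_eq fun k => ?_
      by_cases hk : k = i
      · subst hk
        simpa using hE
      · simpa [hk] using (closedHull_val (B k)).symm
    refine Subtype.ext ?_
    rw [key (C + D) (C.1 ∪ D.1) rfl, complexOp_update_union,
      add_val_of_closedHull_eq (key C C.1 (closedHull_val C).symm)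
        (key D D.1 (closedHull_val D).symm)]

theorem single_op (a : Fin n → A) :
    single (NaryOp.op a) = (NaryOp.op fun i => single (a i) : FinClosed n A) := by
  refine Subtype.ext ?_
  rw [op_val_of_closedHull_eq (Y := fun i => {a i}) fun i => rfl, complexOp, Set.univ_pi_singleton,
    Set.image_singleton]
  rfl

-- `[G]` is the sum of the `[{a}]` over its finitely many generators `a`.
@[elab_as_elim]
theorem single_add_induction {P : FinClosed n A → Prop} (single : ∀ a, P (single a))
    (add : ∀ B C, P B → P C → P (B + C)) (B : FinClosed n A) : P B := by
  obtain ⟨_, G, hfin, hne, rfl⟩ := B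
  induction G, hfin using Set.Finite.induction_on with
  | empty => exact absurd hne Set.not_nonempty_empty
  | @insert a G _ hfin ih =>
    rcases G.eq_empty_or_nonempty with rfl | hG
    · refine (congrArg P (Subtype.ext ?_)).mp (single a)
      exact congrArg (closedHull n) (insert_empty_eq a).symm
    · refine (congrArg P (Subtype.ext ?_)).mp (add _ _ (single a) (ih hG))
      exact (add_val_of_closedHull_eq (Y := {a}) (Z := G) rfl rfl).trans
        (congrArg (closedHull n) (Set.insert_eq a G).symm)

end FinClosed

/-! ### The free idempotent `n`-semigroup -/

namespace FreeINS

variable {n : ℕ} {X : Type*}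

/-- The class of a term. -/
def mk (t : Term n X) : FreeINS n X := Quotient.mk _ t

theorem mk_surjective : Surjective (mk : Term n X → FreeINS n X) := Quotient.exists_rep

theorem sound {s t : Term n X} (h : TermRel n X s t) : mk s = mk t := Quotient.sound h

/-- The operation on classes uses chosen representatives; the congruence rule makes the choice
harmless. -/
theorem mk_op (a : Fin n → Term n X) : mk (NaryOp.op a) = NaryOp.op fun i => mk (a i) :=
  sound (TermRel.congr fun i => TermRel.symm (Quotient.mk_out (s := termSetoid n X) (a i)))

theorem isIdempotentNSemigroup : IsIdempotentNSemigroup n (FreeINS n X) where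
  assoc a i j hi hj := by
    obtain ⟨t, rfl⟩ := mk_surjective.comp_left a
    exact (map_nested mk_op i t).symm.trans
      ((sound (TermRel.assoc t i j hi hj)).trans (map_nested mk_op j t))
  idem a := by
    obtain ⟨t, rfl⟩ := mk_surjective a
    refine (mk_op fun _ => t).symm.trans ?_
    exact sound (TermRel.idem t)

@[elab_as_elim]
theorem induction {P : FreeINS n X → Prop} (of : ∀ x, P (of x))
    (op : ∀ a : Fin n → FreeINS n X, (∀ i, P (a i)) → P (NaryOp.op a)) (a : FreeINS n X) :
    P a := by
  obtain ⟨t, rfl⟩ := mk_surjective a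
  induction t with
  | var x => exact of x
  | op a ih => exact (mk_op a).symm ▸ op _ ih

/-- Evaluation of terms. -/
def eval {A : Type*} [NaryOp n A] (h : X → A) : Term n X → A
  | .var x => h x
  | .op a => NaryOp.op fun i => eval h (a i)

theorem eval_eq_of_termRel {A : Type*} [NaryOp n A] (hA : IsIdempotentNSemigroup n A) (h : X → A)
    {s t : Term n X} (hst : TermRel n X s t) : eval h s = eval h t := by
  induction hst with
  | refl => rfl
  | symm _ ih => exact ih.symm
  | trans _ _ ih₁ ih₂ => exact ih₁.trans ih₂
  | congr _ ih => exact congrArg NaryOp.op (funext ih)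
  | assoc a i j hi hj =>
    rw [map_nested (φ := eval h) fun _ => rfl, map_nested (φ := eval h) fun _ => rfl]
    exact hA.assoc _ i j hi hj
  | idem s => exact hA.idem _

theorem exists_lift {A : Type*} [NaryOp n A] (hA : IsIdempotentNSemigroup n A) (h : X → A) :
    ∃ φ : FreeINS n X → A, (∀ a : Fin n → FreeINS n X,
      φ (NaryOp.op a) = NaryOp.op fun i => φ (a i)) ∧ ∀ x, φ (of x) = h x := by
  refine ⟨Quotient.lift (eval h) fun _ _ => eval_eq_of_termRel hA h, fun a => ?_, fun x => rfl⟩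
  obtain ⟨t, rfl⟩ := mk_surjective.comp_left a
  exact congrArg (Quotient.lift (eval h) fun _ _ => eval_eq_of_termRel hA h) (mk_op t).symm

end FreeINS

/-! ### The free semilattice ordered idempotent `n`-semigroup -/

namespace FreeSL

variable {n : ℕ} {X : Type*}

/-- The class of a term. -/
def mk (t : SLTerm n X) : FreeSL n X := Quotient.mk _ t

theorem mk_surjective : Surjective (mk : SLTerm n X → FreeSL n X) := Quotient.exists_rep

theorem sound {s t : SLTerm n X} (h : SLTermRel n X s t) : mk s = mk t := Quotient.sound h

theorem mk_op (a : Fin n → SLTerm n X) : mk (NaryOp.op a) = NaryOp.op fun i => mk (a i) :=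
  sound (SLTermRel.op_congr fun i => SLTermRel.symm (Quotient.mk_out (s := slTermSetoid n X) (a i)))

theorem mk_op_update (a : Fin n → SLTerm n X) (i : Fin n) (s : SLTerm n X) :
    mk (NaryOp.op (update a i s)) = NaryOp.op (update (fun k => mk (a k)) i (mk s)) := by
  rw [mk_op]
  exact congrArg NaryOp.op (comp_update mk a i s)

theorem isSemilatticeOrdered : IsSemilatticeOrdered n (FreeSL n X) where
  assoc a i j hi hj := by
    obtain ⟨t, rfl⟩ := mk_surjective.comp_left a
    exact (map_nested mk_op i t).symm.trans
      ((sound (SLTermRel.assoc t i j hi hj)).trans (map_nested mk_op j t))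
  idem a := by
    obtain ⟨t, rfl⟩ := mk_surjective a
    refine (mk_op fun _ => t).symm.trans ?_
    exact sound (SLTermRel.idem t)
  add_assoc x y z := by
    obtain ⟨s, rfl⟩ := mk_surjective x
    obtain ⟨t, rfl⟩ := mk_surjective y
    obtain ⟨r, rfl⟩ := mk_surjective z
    exact sound (SLTermRel.add_assoc s t r)
  add_comm x y := by
    obtain ⟨s, rfl⟩ := mk_surjective x
    obtain ⟨t, rfl⟩ := mk_surjective y
    exact sound (SLTermRel.add_comm s t)
  add_idem x := by
    obtain ⟨s, rfl⟩ := mk_surjective x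
    exact sound (SLTermRel.add_idem s)
  op_add a i x y := by
    obtain ⟨r, rfl⟩ := mk_surjective.comp_left a
    obtain ⟨s, rfl⟩ := mk_surjective x
    obtain ⟨t, rfl⟩ := mk_surjective y
    refine (mk_op_update r i (s + t)).symm.trans ((sound (SLTermRel.op_add r i s t)).trans ?_)
    exact congrArg₂ (· + ·) (mk_op_update r i s) (mk_op_update r i t)

@[elab_as_elim]
theorem induction {P : FreeSL n X → Prop} (of : ∀ x, P (of x))
    (op : ∀ a : Fin n → FreeSL n X, (∀ i, P (a i)) → P (NaryOp.op a))
    (add : ∀ a b, P a → P b → P (a + b)) (a : FreeSL n X) : P a := by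
  obtain ⟨t, rfl⟩ := mk_surjective a
  induction t with
  | var x => exact of x
  | op a ih => exact (mk_op a).symm ▸ op _ ih
  | add s t hs ht => exact add _ _ hs ht

/-- Evaluation of terms. -/
def eval {A : Type*} [NaryOp n A] [Add A] (h : X → A) : SLTerm n X → A
  | .var x => h x
  | .op a => NaryOp.op fun i => eval h (a i)
  | .add s t => eval h s + eval h t

theorem eval_eq_of_slTermRel {A : Type*} [NaryOp n A] [Add A] (hA : IsSemilatticeOrdered n A)
    (h : X → A) {s t : SLTerm n X} (hst : SLTermRel n X s t) : eval h s = eval h t := by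
  have eval_update : ∀ (a : Fin n → SLTerm n X) (i : Fin n) (s : SLTerm n X),
      eval h (NaryOp.op (update a i s)) =
        NaryOp.op (update (fun k => eval h (a k)) i (eval h s)) := fun a i s =>
    congrArg NaryOp.op (comp_update (eval h) a i s)
  induction hst with
  | refl => rfl
  | symm _ ih => exact ih.symm
  | trans _ _ ih₁ ih₂ => exact ih₁.trans ih₂
  | op_congr _ ih => exact congrArg NaryOp.op (funext ih)
  | add_congr _ _ ih₁ ih₂ => exact congrArg₂ (· + ·) ih₁ ih₂
  | assoc a i j hi hj =>
    rw [map_nested (φ := eval h) fun _ => rfl, map_nested (φ := eval h) fun _ => rfl]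
    exact hA.assoc _ i j hi hj
  | idem s => exact hA.idem _
  | add_assoc s t r => exact hA.add_assoc _ _ _
  | add_comm s t => exact hA.add_comm _ _
  | add_idem s => exact hA.add_idem _
  | op_add a i s t =>
    rw [eval_update]
    refine (hA.op_add _ i _ _).trans ?_
    rw [← eval_update, ← eval_update]
    rfl

theorem exists_lift {A : Type*} [NaryOp n A] [Add A] (hA : IsSemilatticeOrdered n A) (h : X → A) :
    ∃ g : FreeSL n X → A, IsHom n g ∧ ∀ x, g (of x) = h x := by
  refine ⟨Quotient.lift (eval h) fun _ _ => eval_eq_of_slTermRel hA h,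
    ⟨fun a => ?_, fun x y => ?_⟩, fun x => rfl⟩
  · obtain ⟨t, rfl⟩ := mk_surjective.comp_left a
    exact congrArg (Quotient.lift (eval h) fun _ _ => eval_eq_of_slTermRel hA h) (mk_op t).symm
  · obtain ⟨s, rfl⟩ := mk_surjective x
    obtain ⟨t, rfl⟩ := mk_surjective y
    rfl

theorem hom_ext {A : Type*} [NaryOp n A] [Add A] {g g' : FreeSL n X → A} (hg : IsHom n g)
    (hg' : IsHom n g') (h : ∀ x, g (of x) = g' (of x)) : g = g' := by
  funext a
  induction a using induction with
  | of x => exact h x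
  | op a ih => rw [hg.map_op, hg'.map_op, funext ih]
  | add a b iha ihb => rw [hg.map_add, hg'.map_add, iha, ihb]

end FreeSL

theorem IsHom.id {n : ℕ} {A : Type*} [NaryOp n A] [Add A] : IsHom n (fun a : A => a) :=
  ⟨fun _ => rfl, fun _ _ => rfl⟩

theorem IsHom.comp {n : ℕ} {A B C : Type*} [NaryOp n A] [Add A] [NaryOp n B] [Add B] [NaryOp n C]
    [Add C] {g : B → C} {f : A → B} (hg : IsHom n g) (hf : IsHom n f) :
    IsHom n fun a => g (f a) :=
  ⟨fun a => by rw [hf.map_op, hg.map_op], fun x y => by rw [hf.map_add, hg.map_add]⟩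

/-! ### The universal property of the finitely generated closed `n`-semigroups -/

namespace FinClosed

variable {n : ℕ} {X A : Type*} [NaryOp n A] [Add A]

theorem hom_ext {g g' : FinClosed n (FreeINS n X) → A} (hg : IsHom n g) (hg' : IsHom n g')
    (h : ∀ x, g (single (FreeINS.of x)) = g' (single (FreeINS.of x))) : g = g' := by
  funext B
  induction B using single_add_induction with
  | single a =>
    induction a using FreeINS.induction with
    | of x => exact h x
    | op a ih => rw [single_op, hg.map_op, hg'.map_op, funext ih]
  | add B C ihB ihC => rw [hg.map_add, hg'.map_add, ihB, ihC]

theorem exists_lift (hn : 0 < n) (hA : IsSemilatticeOrdered n A) (h : X → A) :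
    ∃ g : FinClosed n (FreeINS n X) → A,
      IsHom n g ∧ ∀ x, g (single (FreeINS.of x)) = h x := by
  -- Here `⊔` is `+` by definition, so `hA.op_add` serves as distributivity over joins.
  let := hA.semilatticeSup
  obtain ⟨φ, hφ, hφX⟩ := FreeINS.exists_lift hA.toIsIdempotentNSemigroup h
  have hidem := hA.idem
  choose g hg using exists_isLUB hn hA.op_add hidem hφ
  refine ⟨g, ⟨fun B => ?_, fun B C => ?_⟩, fun x => ?_⟩
  · exact (hg _).unique (isLUB_op hn hA.op_add hidem hφ fun i => hg (B i))
  · exact (hg _).unique (isLUB_add hn hA.op_add hidem hφ (hg B) (hg C))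
  · refine (hg _).unique ((isLUB_image_closedHull hn hA.op_add hidem hφ).2 ?_)
    rw [Set.image_singleton, hφX]
    exact isLUB_singleton

end FinClosed

end NSgp

theorem theorem6p2 (n : ℕ) (hn : 2 ≤ n) (X : Type u) :
    -- the finitely generated closed `n`-semigroups form a member of the variety
    NSgp.IsSemilatticeOrdered n (NSgp.FinClosed n (NSgp.FreeINS n X)) ∧
    -- which is isomorphic to the free algebra, compatibly with the generators
    (∃ e : NSgp.FreeSL n X ≃ NSgp.FinClosed n (NSgp.FreeINS n X),
      NSgp.IsHom n e ∧ ∀ x : X, e (NSgp.FreeSL.of x) =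
        NSgp.FinClosed.single (NSgp.FreeINS.of x)) ∧
    -- and has the universal property of the free algebra over `X`
    (∀ (A : Type v) [NaryOp n A] [Add A], NSgp.IsSemilatticeOrdered n A → ∀ h : X → A,
      ∃! g : NSgp.FinClosed n (NSgp.FreeINS n X) → A,
        NSgp.IsHom n g ∧ ∀ x : X, g (NSgp.FinClosed.single (NSgp.FreeINS.of x)) = h x) := by
  have hn0 : 0 < n := by omega
  have hS := NSgp.FinClosed.isSemilatticeOrdered
    (NSgp.FreeINS.isIdempotentNSemigroup (n := n) (X := X))
  refine ⟨hS, ?_, fun A _ _ hA h => ?_⟩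
  · obtain ⟨e, he, heX⟩ := NSgp.FreeSL.exists_lift hS
      fun x : X => NSgp.FinClosed.single (NSgp.FreeINS.of x)
    -- The inverse comes from the other universal property; both composites fix the generators,
    -- hence are identities.
    obtain ⟨g, hg, hgX⟩ := NSgp.FinClosed.exists_lift hn0 NSgp.FreeSL.isSemilatticeOrdered
      (NSgp.FreeSL.of (n := n) (X := X))
    refine ⟨⟨e, g, fun a => ?_, fun B => ?_⟩, he, heX⟩
    · exact congrFun (NSgp.FreeSL.hom_ext (hg.comp he) .id fun x => by rw [heX, hgX]) a
    · exact congrFun (NSgp.FinClosed.hom_ext (he.comp hg) .id fun x => by rw [hgX, heX]) B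
  · obtain ⟨g, hg, hgX⟩ := NSgp.FinClosed.exists_lift hn0 hA h
    exact ⟨g, ⟨hg, hgX⟩, fun g' hg' =>
      NSgp.FinClosed.hom_ext hg'.1 hg fun x => (hg'.2 x).trans (hgX x).symm⟩
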